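/- Let $K$ be a field, $n\ge 0$, and $S=K[x_1,\dots,x_n]$ with its $\mathbb{Z}^n$-grading. For an ideal $I\subset S$, a Stanley decomposition of $I$ is a finite direct sum decomposition $I=\bigoplus_{i=1}^m u_iK[Z_i]$ into $K$-subspaces, where each $u_i\in I$ is a nonzero scalar multiple of a monomial and each $Z_i$ is a subset of $\{x_1,\dots,x_n\}$. The Stanley depth $\operatorname{sdepth}(I)$ of a nonzero monomial ideal $I$ is the maximum, over all Stanley decompositions of $I$, of $\min_{1\le i\le m}|Z_i|$. **Theorem.** Let $I\subset S$ be a squarefree monomial ideal (an ideal generated by squarefree monomials) that can be generated by three monomials $v_1,v_2,v_3$, not necessarily distinct and not necessarily a minimal system of generators. Then $\operatorname{sdepth}(I)\ge n-1$. If moreover $I$ is not principal, then $\operatorname{sdepth}(I)=n-1$. -/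

import Mathlib

/-- `I` is a squarefree monomial ideal of `K[x_1,…,x_n]`: it is generated by monomials `x^a`
all of whose exponents are `0` or `1`. -/
def IsSquarefreeMonomialIdeal {K : Type*} [Field K] {n : ℕ}
    (I : Ideal (MvPolynomial (Fin n) K)) : Prop :=
  ∃ A : Set (Fin n →₀ ℕ), (∀ a ∈ A, ∀ i, a i ≤ 1) ∧
    I = Ideal.span ((fun a => MvPolynomial.monomial a (1 : K)) '' A)

/-- The `K`-subspace `u K[Z]` of `K[x_1,…,x_n]`, where `Z` is a set of variables. -/
noncomputable def stanleySpace {K : Type*} [Field K] {n : ℕ}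
    (u : MvPolynomial (Fin n) K) (Z : Finset (Fin n)) : Submodule K (MvPolynomial (Fin n) K) :=
  (Subalgebra.toSubmodule (MvPolynomial.supported K (Z : Set (Fin n)))).map (LinearMap.mulLeft K u)

/-- A Stanley decomposition `I = ⨁ i, u_i K[Z_i]` of an ideal `I` of `K[x_1,…,x_n]`: a finite
internal direct sum of `K`-subspaces `u_i K[Z_i]` with `u_i ≠ 0` homogeneous for the
`ℤ^n`-grading, that is, a nonzero scalar times a monomial. -/
structure StanleyDecomposition {K : Type*} [Field K] {n : ℕ}
    (I : Ideal (MvPolynomial (Fin n) K)) where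
  m : ℕ
  u : Fin m → MvPolynomial (Fin n) K
  Z : Fin m → Finset (Fin n)
  homogeneous : ∀ i, ∃ (a : Fin n →₀ ℕ) (c : K), c ≠ 0 ∧ u i = MvPolynomial.monomial a c
  independent : iSupIndep (fun i => stanleySpace (u i) (Z i))
  iSup_eq : ⨆ i, stanleySpace (u i) (Z i) = I.restrictScalars K

/-- The Stanley depth of a decomposition: the minimum of the `|Z_i|`
(a genuine minimum whenever `I ≠ 0`, since then there is at least one summand). -/
noncomputable def StanleyDecomposition.depth {K : Type*} [Field K] {n : ℕ}
    {I : Ideal (MvPolynomial (Fin n) K)} (D : StanleyDecomposition I) : ℕ :=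
  ⨅ i, (D.Z i).card

/-- The Stanley depth of `I`: the maximum of the depths of its Stanley decompositions. These
depths are bounded by `n` (see `StanleyDecomposition.depth_le`), so the supremum is attained as
soon as `I` has a Stanley decomposition. -/
noncomputable def sdepth {K : Type*} [Field K] {n : ℕ}
    (I : Ideal (MvPolynomial (Fin n) K)) : ℕ :=
  sSup (Set.range (fun D : StanleyDecomposition I => D.depth))

theorem StanleyDecomposition.depth_le {K : Type*} [Field K] {n : ℕ}
    {I : Ideal (MvPolynomial (Fin n) K)} (D : StanleyDecomposition I) : D.depth ≤ n := by
  unfold StanleyDecomposition.depth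
  rcases isEmpty_or_nonempty (Fin D.m) with h | ⟨⟨i⟩⟩
  · simp
  · exact (ciInf_le (OrderBot.bddBelow _) i).trans (card_finset_fin_le _)

/-!
A set `B = {s | e ≤ s, s j = e j for j ∉ Z}` of exponents (a *box*) corresponds to the Stanley space
`x^e K[Z]`, and every set `T` of exponents to the subspace of polynomials with support in `T`.
Unions and disjointness of sets correspond to sums and independence of subspaces, so a Stanley
decomposition of a monomial ideal is the same as a finite partition of the exponents of its
monomials into boxes (`exists_stanleyDecomposition_of_partition`).

For an ideal generated by `x^a, x^b, x^c`, the exponents `s` of its monomials fall into exactly one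
of the four classes
`a ≤ s, ¬ c ≤ s`;  `b ≤ s, ¬ a ≤ s`;  `c ≤ s, ¬ b ≤ s`;  `a ⊔ b ⊔ c ≤ s`:
if some but not all of the three generators divide `x^s`, then going around the cycle there is
exactly one place where a dividing generator follows a non-dividing one. The last class is a
box with all `n` variables free. A class `a ≤ s, ¬ c ≤ s` is the disjoint union of finitely many
boxes with `n - 1` free variables: sort the elements by the first coordinate `i` with `s i < c i`
and by the value of `s i` (`existsUnique_mem_exponentBox_gapExponent`). Hence `sdepth I ≥ n - 1`.

Conversely, in a decomposition of depth `n` all summands are principal ideals `u_i S`. Two nonzero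
ideals of a domain always meet, so there is at most one summand and the ideal is principal
(`isPrincipal_of_le_depth`).
-/

open MvPolynomial in
/-- Polynomials with support in a union are sums of polynomials with support in the pieces. -/
theorem MvPolynomial.restrictSupport_iUnion {R σ : Type*} {ι : Sort*} [CommSemiring R]
    (s : ι → Set (σ →₀ ℕ)) :
    restrictSupport R (⋃ i, s i) = ⨆ i, restrictSupport R (s i) := by
  simp only [restrictSupport_eq_span, Set.image_iUnion, Submodule.span_iUnion]

open MvPolynomial in
theorem MvPolynomial.disjoint_restrictSupport {R σ : Type*} [CommSemiring R]
    {s t : Set (σ →₀ ℕ)} (h : Disjoint s t) :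
    Disjoint (restrictSupport R s) (restrictSupport R t) := by
  rw [Submodule.disjoint_def]
  intro p hs ht
  rw [mem_restrictSupport_iff] at hs ht
  rw [← support_eq_empty, ← Finset.coe_eq_empty]
  exact Set.subset_eq_empty (Set.subset_inter hs ht) h.inter_eq

open MvPolynomial in
theorem MvPolynomial.iSupIndep_restrictSupport {R σ ι : Type*} [CommSemiring R]
    {s : ι → Set (σ →₀ ℕ)} (h : Pairwise (Function.onFun Disjoint s)) :
    iSupIndep fun i => restrictSupport R (s i) := by
  intro i
  have hsup : ⨆ j, ⨆ _ : j ≠ i, restrictSupport R (s j) =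
      restrictSupport R (⋃ j, ⋃ _ : j ≠ i, s j) := by
    simp only [restrictSupport_iUnion]
  refine (disjoint_restrictSupport ?_).mono_right hsup.le
  simp only [Set.disjoint_iUnion_right]
  exact fun j hj => h hj.symm

/-! ### Boxes and Stanley decompositions -/

/-- The exponents of the monomials in `x^e K[Z]`. -/
def exponentBox {σ : Type*} (e : σ →₀ ℕ) (Z : Finset σ) : Set (σ →₀ ℕ) :=
  {s | e ≤ s ∧ ∀ j ∉ Z, s j = e j}

open MvPolynomial in
theorem stanleySpace_monomial {K : Type*} [Field K] {n : ℕ} (e : Fin n →₀ ℕ)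
    (Z : Finset (Fin n)) :
    stanleySpace (monomial e (1 : K)) Z = restrictSupport K (exponentBox e Z) := by
  have hsupp : Subalgebra.toSubmodule (supported K (Z : Set (Fin n))) =
      restrictSupport K {d | d.support ⊆ Z} := by
    ext p
    rw [Subalgebra.mem_toSubmodule, mem_supported, mem_restrictSupport_iff]
    constructor
    · intro h d hd i hi
      exact h ((mem_vars_iff_mem_support i).2 ⟨d, hd, hi⟩)
    · intro h i hi
      obtain ⟨d, hd, hid⟩ := (mem_vars_iff_mem_support i).1 hi
      exact h hd hid
  have himage : exponentBox e Z = (fun d => e + d) '' {d : Fin n →₀ ℕ | d.support ⊆ Z} := by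
    ext s
    constructor
    · rintro ⟨h1, h2⟩
      refine ⟨s - e, fun i hi => ?_, add_tsub_cancel_of_le h1⟩
      by_contra hiZ
      simp [h2 i hiZ] at hi
    · rintro ⟨d, hd, rfl⟩
      refine ⟨le_self_add, fun j hj => ?_⟩
      have : d j = 0 := Finsupp.notMem_support_iff.1 fun h => hj (hd h)
      simp [this]
  rw [stanleySpace, hsupp, himage, restrictSupport_eq_span, restrictSupport_eq_span,
    Submodule.map_span, Set.image_image, Set.image_image]
  simp [monomial_mul]

open MvPolynomial in
theorem restrictScalars_span_monomial {K σ ι : Type*} [Field K] (v : ι → σ →₀ ℕ) :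
    (Ideal.span (Set.range fun i => monomial (v i) (1 : K))).restrictScalars K =
      restrictSupport K {s | ∃ i, v i ≤ s} := by
  ext p
  have : (Set.range fun i => monomial (v i) (1 : K)) =
      (fun s => monomial s (1 : K)) '' Set.range v := (Set.range_comp (fun s => monomial s (1 : K)) v)
  rw [Submodule.restrictScalars_mem, this, mem_ideal_span_monomial_image,
    mem_restrictSupport_iff]
  simp [Set.subset_def]

theorem exists_stanleyDecomposition_of_partition {K : Type*} [Field K] {n : ℕ} {ι κ : Type*}
    [Fintype κ] [Nonempty κ] (v : ι → Fin n →₀ ℕ) (e : κ → Fin n →₀ ℕ) (Z : κ → Finset (Fin n))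
    (hmem : ∀ k, ∀ s ∈ exponentBox (e k) (Z k), ∃ i, v i ≤ s)
    (huniq : ∀ s, (∃ i, v i ≤ s) → ∃! k, s ∈ exponentBox (e k) (Z k))
    {d : ℕ} (hd : ∀ k, d ≤ (Z k).card) :
    ∃ D : StanleyDecomposition
      (Ideal.span (Set.range fun i => MvPolynomial.monomial (v i) (1 : K))), d ≤ D.depth := by
  let φ := (Fintype.equivFin κ).symm
  have hindep : iSupIndep fun k => stanleySpace (MvPolynomial.monomial (e k) (1 : K)) (Z k) := by
    simp only [stanleySpace_monomial]
    refine MvPolynomial.iSupIndep_restrictSupport fun k l hkl => ?_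
    refine Set.disjoint_left.2 fun s hk hl => hkl ?_
    exact (huniq s (hmem k s hk)).unique hk hl
  have hsup : ⨆ k, stanleySpace (MvPolynomial.monomial (e k) (1 : K)) (Z k) =
      (Ideal.span (Set.range fun i => MvPolynomial.monomial (v i) (1 : K))).restrictScalars K := by
    simp only [stanleySpace_monomial]
    rw [← MvPolynomial.restrictSupport_iUnion, restrictScalars_span_monomial]
    congr 1
    ext s
    rw [Set.mem_iUnion]
    exact ⟨fun ⟨k, hk⟩ => hmem k s hk, fun h => (huniq s h).exists⟩
  refine ⟨⟨Fintype.card κ, fun i => MvPolynomial.monomial (e (φ i)) 1, fun i => Z (φ i),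
    fun i => ⟨_, 1, one_ne_zero, rfl⟩, hindep.comp φ.injective, ?_⟩, ?_⟩
  · rw [← hsup]
    exact φ.iSup_comp
      (g := fun k => stanleySpace (MvPolynomial.monomial (e k) (1 : K)) (Z k))
  · have : Nonempty (Fin (Fintype.card κ)) := φ.nonempty
    exact le_ciInf fun i => hd (φ i)

/-! ### Partitioning the exponents above `a` and not above `c` -/

/-- The smallest exponent `s ≥ a` whose value at `i` is `k` and which satisfies `c j ≤ s j`
for all `j < i` (where `a i ≤ k` is assumed). -/
noncomputable def gapExponent {n : ℕ} (a c : Fin n →₀ ℕ) (i : Fin n) (k : ℕ) : Fin n →₀ ℕ :=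
  Finsupp.equivFunOnFinite.symm fun j => if j < i then a j ⊔ c j else if j = i then k else a j

theorem mem_exponentBox_gapExponent {n : ℕ} {a c s : Fin n →₀ ℕ} {i : Fin n} {k : ℕ}
    (hk : a i ≤ k ∧ k < c i) :
    s ∈ exponentBox (gapExponent a c i k) {i}ᶜ ↔
      a ≤ s ∧ s i = k ∧ ∀ j < i, c j ≤ s j := by
  have hval : ∀ j, gapExponent a c i k j =
      if j < i then a j ⊔ c j else if j = i then k else a j := fun j => rfl
  simp only [exponentBox, Set.mem_ofPred_eq, Finsupp.le_def, hval]
  constructor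
  · rintro ⟨h1, h2⟩
    have hi : s i = k := by simpa using h2 i (by simp)
    refine ⟨fun j => ?_, hi, fun j hj => ?_⟩
    · have := h1 j
      split_ifs at this with h h'
      · exact le_sup_left.trans this
      · subst h'; omega
      · exact this
    · have := h1 j
      rw [if_pos hj] at this
      exact le_sup_right.trans this
  · rintro ⟨h1, h2, h3⟩
    refine ⟨fun j => ?_, fun j hj => ?_⟩
    · split_ifs with h h'
      · exact sup_le (h1 j) (h3 j h)
      · subst h'; exact h2.ge
      · exact h1 j
    · obtain rfl : j = i := by simpa using hj
      simpa using h2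

theorem mem_of_mem_exponentBox_gapExponent {n : ℕ} {a c s : Fin n →₀ ℕ} {i : Fin n}
    (k : Finset.Ico (a i) (c i)) (h : s ∈ exponentBox (gapExponent a c i k) {i}ᶜ) :
    a ≤ s ∧ ¬ c ≤ s := by
  have hk := Finset.mem_Ico.1 k.2
  obtain ⟨h1, h2, -⟩ := (mem_exponentBox_gapExponent hk).1 h
  exact ⟨h1, fun hc => absurd (hc i) (by omega)⟩

/-- Each `s` above `a` and not above `c` lies in the box given by the first coordinate `i` with
`s i < c i` and by the value `s i`, and in no other one. -/
theorem existsUnique_mem_exponentBox_gapExponent {n : ℕ} {a c s : Fin n →₀ ℕ}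
    (ha : a ≤ s) (hc : ¬ c ≤ s) :
    ∃! q : Σ i, Finset.Ico (a i) (c i), s ∈ exponentBox (gapExponent a c q.1 q.2) {q.1}ᶜ := by
  have hex : ∃ i, s i < c i := by
    by_contra! h
    exact hc h
  obtain ⟨i, hi, hmin⟩ := WellFounded.has_min (wellFounded_lt (α := Fin n)) {i | s i < c i} hex
  have hlt : ∀ j < i, c j ≤ s j := fun j hj => not_lt.1 fun h => hmin j h hj
  refine ⟨⟨i, s i, Finset.mem_Ico.2 ⟨ha i, hi⟩⟩,
    (mem_exponentBox_gapExponent ⟨ha i, hi⟩).2 ⟨ha, rfl, hlt⟩, ?_⟩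
  rintro ⟨i', k, hk⟩ hmem
  have hk' := Finset.mem_Ico.1 hk
  obtain ⟨-, h2, h3⟩ := (mem_exponentBox_gapExponent hk').1 hmem
  subst h2
  obtain rfl : i' = i := by
    rcases lt_trichotomy i' i with h | h | h
    · exact absurd (hlt i' h) (by omega)
    · exact h
    · exact absurd (h3 i h) (not_le.2 hi)
  rfl

/-! ### The two bounds -/

/-- The cyclic partition: the box `none` consists of the common multiples of all generators, and
the boxes indexed by `some ⟨p, _⟩` partition the exponents above `v p` and not above the cyclic
predecessor `v (p - 1)`. -/
theorem exists_stanleyDecomposition_three {K : Type*} [Field K] {n : ℕ}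
    (v : Fin 3 → Fin n →₀ ℕ) :
    ∃ D : StanleyDecomposition
      (Ideal.span (Set.range fun i => MvPolynomial.monomial (v i) (1 : K))), n - 1 ≤ D.depth := by
  let κ := Option (Σ p : Fin 3, Σ i : Fin n, Finset.Ico (v p i) (v (p - 1) i))
  let e : κ → Fin n →₀ ℕ := fun k =>
    k.elim (v 0 ⊔ v 1 ⊔ v 2) fun q => gapExponent (v q.1) (v (q.1 - 1)) q.2.1 q.2.2
  let Z : κ → Finset (Fin n) := fun k => k.elim Finset.univ fun q => {q.2.1}ᶜ
  have hnone : ∀ s, s ∈ exponentBox (e none) (Z none) ↔ ∀ p, v p ≤ s := by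
    intro s
    simp [e, Z, exponentBox, Fin.forall_fin_succ, and_assoc]
  have hsome : ∀ q s, s ∈ exponentBox (e (some q)) (Z (some q)) →
      v q.1 ≤ s ∧ ¬ v (q.1 - 1) ≤ s :=
    fun q s h => mem_of_mem_exponentBox_gapExponent q.2.2 h
  refine exists_stanleyDecomposition_of_partition v e Z ?_ ?_ ?_
  · rintro (_ | q) s hs
    · exact ⟨0, (hnone s).1 hs 0⟩
    · exact ⟨q.1, (hsome q s hs).1⟩
  · intro s hs
    by_cases hall : ∀ p, v p ≤ s
    · refine ⟨none, (hnone s).2 hall, ?_⟩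
      rintro (_ | q) hq
      · rfl
      · exact absurd (hall _) (hsome q s hq).2
    · -- In a cyclic word of length three that is not constant, there is exactly one ascent.
      have hcyc : ∀ P : Fin 3 → Prop, (∃ p, P p) → (¬ ∀ p, P p) →
          ∃! p, P p ∧ ¬ P (p - 1) := by
        intro P h1 h2
        have e0 : (0 : Fin 3) - 1 = 2 := rfl
        have e1 : (1 : Fin 3) - 1 = 0 := rfl
        have e2 : (2 : Fin 3) - 1 = 1 := rfl
        simp only [ExistsUnique, Fin.exists_fin_succ, Fin.forall_fin_succ, IsEmpty.forall_iff,
          IsEmpty.exists_iff, Fin.succ_zero_eq_one, Fin.succ_one_eq_two, e0, e1, e2,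
          or_false, and_true] at h1 h2 ⊢
        by_cases P 0 <;> by_cases P 1 <;> by_cases P 2 <;> simp_all
      obtain ⟨p, ⟨hp, hp'⟩, hpu⟩ := hcyc (fun p => v p ≤ s) hs hall
      obtain ⟨r, hr, hru⟩ := existsUnique_mem_exponentBox_gapExponent hp hp'
      refine ⟨some ⟨p, r⟩, hr, ?_⟩
      rintro (_ | ⟨p', r'⟩) hq
      · exact absurd ((hnone s).1 hq) hall
      · obtain rfl : p' = p := hpu p' (hsome _ s hq)
        rw [hru r' hq]
  · rintro (_ | q)
    · simp [Z]
    · simp [Z, Finset.card_compl]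

theorem stanleySpace_univ {K : Type*} [Field K] {n : ℕ} (u : MvPolynomial (Fin n) K) :
    stanleySpace u Finset.univ = (Ideal.span {u}).restrictScalars K := by
  ext p
  simp [stanleySpace, Ideal.mem_span_singleton', mul_comm u]

theorem isPrincipal_of_le_depth {K : Type*} [Field K] {n : ℕ}
    {I : Ideal (MvPolynomial (Fin n) K)} (D : StanleyDecomposition I) (hD : n ≤ D.depth) :
    Submodule.IsPrincipal I := by
  have hZ : ∀ i, D.Z i = Finset.univ := fun i =>
    Finset.eq_univ_of_card _ <| le_antisymm (Finset.card_le_univ _) <| by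
      rw [Fintype.card_fin]
      exact hD.trans (ciInf_le (OrderBot.bddBelow _) i)
  have hne : ∀ i, D.u i ≠ 0 := by
    intro i
    obtain ⟨a, c, hc, h⟩ := D.homogeneous i
    rwa [h, Ne, MvPolynomial.monomial_eq_zero]
  have hspace : ∀ i, stanleySpace (D.u i) (D.Z i) =
      (Ideal.span {D.u i}).restrictScalars K := fun i => by rw [hZ i, stanleySpace_univ]
  have hsub : Subsingleton (Fin D.m) := by
    refine ⟨fun i j => by_contra fun hij => mul_ne_zero (hne i) (hne j) ?_⟩
    refine Submodule.disjoint_def.1 (D.independent.pairwiseDisjoint hij) _ ?_ ?_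
    · simp only [hspace, Submodule.restrictScalars_mem]
      exact Ideal.mul_mem_right _ _ (Ideal.mem_span_singleton_self _)
    · simp only [hspace, Submodule.restrictScalars_mem]
      exact Ideal.mul_mem_left _ _ (Ideal.mem_span_singleton_self _)
  have hsup := D.iSup_eq
  rcases isEmpty_or_nonempty (Fin D.m) with hm | ⟨⟨i⟩⟩
  · rw [iSup_of_empty] at hsup
    have : I = ⊥ := (Submodule.restrictScalars_eq_bot_iff K _ _).1 hsup.symm
    rw [this]
    infer_instance
  · have : Unique (Fin D.m) := ⟨⟨i⟩, fun j => Subsingleton.elim j i⟩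
    rw [iSup_unique, hspace] at hsup
    exact ⟨_, (Submodule.restrictScalars_injective K _ _ hsup).symm⟩

theorem mainTheorem2 {K : Type*} [Field K] {n : ℕ} (I : Ideal (MvPolynomial (Fin n) K))
    (hI : IsSquarefreeMonomialIdeal I) (v : Fin 3 → (Fin n →₀ ℕ))
    (hv : I = Ideal.span (Set.range (fun i => MvPolynomial.monomial (v i) (1 : K)))) :
    (n : ℤ) - 1 ≤ (sdepth I : ℤ) ∧
      (¬ Submodule.IsPrincipal I → (sdepth I : ℤ) = (n : ℤ) - 1) := by
  obtain ⟨D, hD⟩ : ∃ D : StanleyDecomposition I, n - 1 ≤ D.depth := by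
    rw [hv]
    exact exists_stanleyDecomposition_three v
  have hbdd : BddAbove (Set.range fun D : StanleyDecomposition I => D.depth) :=
    ⟨n, by rintro _ ⟨D, rfl⟩; exact D.depth_le⟩
  have hlow : n - 1 ≤ sdepth I := hD.trans (le_csSup hbdd ⟨D, rfl⟩)
  refine ⟨by omega, fun hprin => ?_⟩
  -- The supremum is attained, so `n ≤ sdepth I` would give a decomposition of depth `n`.
  obtain ⟨D', hD'⟩ : sdepth I ∈ Set.range fun D : StanleyDecomposition I => D.depth :=
    Nat.sSup_mem ⟨_, D, rfl⟩ hbdd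
  have hlt : sdepth I < n := by
    by_contra! h
    exact hprin (isPrincipal_of_le_depth D' (h.trans hD'.ge))
  omega
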